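/- Let $\psi:\{1,2,3,\dots\}\to(0,\infty)$ be a positive, non-increasing sequence, and let $\theta$ be an irrational real number with principal convergents $p_k/q_k$ ($k\ge 0$), i.e. the convergents, in lowest terms with $q_k\ge 1$, of the regular continued fraction expansion of $\theta$, indexed so that $p_0/q_0=\lfloor\theta\rfloor/1$. Write $\|x\|$ for the distance from the real number $x$ to the nearest integer. Then, for Lebesgue-almost every $s\in\mathbb{R}$, \[ \|n\theta-s\|<\psi(n)\quad\text{for infinitely many positive integers } n \] if and only if \[ \sum_{k=0}^{\infty}\left(\sum_{n=q_k}^{q_{k+1}-1}\min\bigl(\psi(n),\|q_k\theta\|\bigr)\right)=\infty . \] That is: if the series diverges, then for almost every $s$ the inequality has infinitely many solutions $n$; if it converges, then for almost every $s$ it has only finitely many. -/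

import Mathlib

/-- The distance from a real number to the nearest integer. -/
noncomputable def distNearestInt (x : ℝ) : ℝ := |x - round x|

/-- The denominator `q_k` (in lowest terms) of the `k`-th principal convergent `p_k / q_k` of the
continued fraction expansion of `θ`; the index starts at `k = 0`, with `p_0 / q_0 = ⌊θ⌋ / 1`. -/
noncomputable def convergentDen (θ : ℝ) (k : ℕ) : ℕ := (θ.convergent k).den

/-!
Write `α` for the class of `θ` in `ℝ / ℤ`, `δ n` for the least of `‖α‖, …, ‖n • α‖`, and
`g n = min (ψ n) (δ n)`. The denominators of the convergents are the closest return times of `α`,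
so `δ n = ‖q_k θ‖` for `q_k ≤ n < q_{k + 1}` and the series is `∑ g n`.

If it converges, cover the union of the arcs `B(n • α, ψ n)`, `n ≥ a`, in order. The arc at time
`a + t` has an earlier one at distance `δ t` from it, so it adds measure at most `2 g t`; the
first `a` arcs add at most `2 a ψ a`. When `n + 1` is a closest return, `(n + 1) δ n ≥ 1 / 2`,
while `n g n → 0` since `g` is monotone and summable. Hence `g a = ψ a` for infinitely many `a`,
along which both contributions tend to `0`.

If it diverges, shrink the arcs to radius `g n / 4`. Two of them, at times `n < m`, meet only if
the orbit returns from `n` to `m` within `g n / 2`. For a closest return time `L + 1` with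
`δ L ≤ g n`, a window of `L + 1` times contains `O((L + 1) g n)` such returns, because they are
`δ L`-separated and `(L + 1) δ L ≥ 1 / 2`; for fixed `m`, at most one of the times `n` whose arc
meets the one at `m` admits no such `L < m`. So the shrunk arcs are quasi-independent
on average, the limsup set has positive measure by the Kochen–Stone lemma, and full measure by
ergodicity of the rotation by `α`.
-/

open MeasureTheory Set Filter Topology Metric

section ReturnDist

variable {E : Type*} [SeminormedAddCommGroup E]

/-- The smallest distance to `0` reached by the first `n` multiples `α, 2α, …, nα`. The value at
`n = 0` is the one at `n = 1`, which makes the sequence antitone on all of `ℕ`. -/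
noncomputable def returnDist (α : E) : ℕ → ℝ
  | 0 => ‖α‖
  | n + 1 => min (returnDist α n) ‖(n + 1) • α‖

/-- The time `n + 1` is a closest return: `(n + 1) • α` is strictly closer to `0` than every
earlier positive multiple of `α`. -/
def ReturnsCloser (α : E) (n : ℕ) : Prop :=
  ‖(n + 1) • α‖ < returnDist α n

/-- The radius `ψ n` truncated at the return distance. Its sum is the series of the theorem. -/
noncomputable def returnWeight (ψ : ℕ → ℝ) (α : E) (n : ℕ) : ℝ :=
  min (ψ n) (returnDist α n)

variable {α : E}

theorem returnDist_antitone : Antitone (returnDist α) :=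
  antitone_nat_of_succ_le fun _ => min_le_left _ _

theorem returnDist_le_norm_nsmul {n j : ℕ} (hj : 1 ≤ j) (hjn : j ≤ n) :
    returnDist α n ≤ ‖j • α‖ := by
  obtain ⟨i, rfl⟩ := Nat.exists_eq_add_of_le' hj
  exact (returnDist_antitone hjn).trans (min_le_right _ _)

theorem exists_norm_nsmul_eq_returnDist {n : ℕ} (hn : 1 ≤ n) :
    ∃ j, 1 ≤ j ∧ j ≤ n ∧ ‖j • α‖ = returnDist α n := by
  induction n, hn using Nat.le_induction with
  | base => exact ⟨1, le_rfl, le_rfl, by simp [returnDist]⟩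
  | succ n _ ih =>
    rcases le_total (returnDist α n) ‖(n + 1) • α‖ with h | h
    · obtain ⟨j, hj1, hjn, hj⟩ := ih
      exact ⟨j, hj1, hjn.trans n.le_succ, hj.trans (min_eq_left h).symm⟩
    · exact ⟨n + 1, n.succ_pos, le_rfl, (min_eq_right h).symm⟩

theorem returnDist_nonneg (n : ℕ) : 0 ≤ returnDist α n := by
  induction n with
  | zero => exact norm_nonneg _
  | succ n ih => exact le_min ih (norm_nonneg _)

theorem returnDist_eq_or_exists_returnsCloser {l d : ℕ} (hld : l ≤ d) :
    returnDist α d = returnDist α l ∨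
      ∃ n, l ≤ n ∧ n < d ∧ ReturnsCloser α n ∧ returnDist α n = returnDist α l := by
  induction d, hld using Nat.le_induction with
  | base => exact .inl rfl
  | succ d hld ih =>
    rcases ih with h | ⟨n, hln, hnd, hn⟩
    · rcases lt_or_ge ‖(d + 1) • α‖ (returnDist α d) with hd | hd
      · exact .inr ⟨d, hld, d.lt_succ_self, hd, h⟩
      · exact .inl ((min_eq_left hd).trans h)
    · exact .inr ⟨n, hln, hnd.trans d.lt_succ_self, hn⟩

theorem returnWeight_antitone {ψ : ℕ → ℝ} (hψ : Antitone ψ) : Antitone (returnWeight ψ α) :=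
  hψ.min returnDist_antitone

theorem returnWeight_nonneg {ψ : ℕ → ℝ} (hψ : 0 ≤ ψ) (n : ℕ) : 0 ≤ returnWeight ψ α n :=
  le_min (hψ n) (returnDist_nonneg n)

theorem dist_nsmul_nsmul {n m : ℕ} (h : n ≤ m) :
    dist (m • α) (n • α) = ‖(m - n) • α‖ := by
  rw [dist_eq_norm, sub_nsmul α h, sub_eq_add_neg]

end ReturnDist

section ClosestReturn

variable {α : UnitAddCircle}

theorem exists_int_norm_nsmul_coe_eq (ξ : ℝ) (n : ℕ) :
    ∃ p : ℤ, ‖n • (ξ : UnitAddCircle)‖ = |n * ξ - p| :=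
  ⟨round (n * ξ), by rw [← AddCircle.coe_nsmul, UnitAddCircle.norm_eq, nsmul_eq_mul]⟩

/-- The determinant of the two approximations `j ξ ≈ p` and `k ξ ≈ q` is a nonzero integer. -/
theorem one_le_two_mul_mul_abs_sub {ξ : ℝ} {j k : ℕ} {p q : ℤ} (hj : 1 ≤ j) (hjk : j ≤ k)
    (h : |k * ξ - q| < |j * ξ - p|) : 1 ≤ 2 * (k * |j * ξ - p|) := by
  have hjk' : (j : ℝ) ≤ k := Nat.cast_le.2 hjk
  have hj0 : (0 : ℝ) < j := Nat.cast_pos.2 hj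
  have hsmall : j * |k * ξ - q| < k * |j * ξ - p| :=
    (mul_lt_mul_of_pos_left h hj0).trans_le (mul_le_mul_of_nonneg_right hjk' (abs_nonneg _))
  have hdet : ((j * q - k * p : ℤ) : ℝ) = k * (j * ξ - p) - j * (k * ξ - q) := by
    push_cast; ring
  have hne : j * q - k * p ≠ 0 := fun h0 => by
    rw [h0, Int.cast_zero, eq_comm, sub_eq_zero] at hdet
    have := congrArg abs hdet
    rw [abs_mul, abs_mul, Nat.abs_cast, Nat.abs_cast] at this
    exact hsmall.ne' this
  have hone : (1 : ℝ) ≤ |((j * q - k * p : ℤ) : ℝ)| := by exact_mod_cast Int.one_le_abs hne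
  rw [hdet] at hone
  have := hone.trans (abs_sub _ _)
  rw [abs_mul, abs_mul, Nat.abs_cast, Nat.abs_cast] at this
  linarith

theorem ReturnsCloser.half_le {n : ℕ} (h : ReturnsCloser α n) :
    1 / 2 ≤ (n + 1) * returnDist α n := by
  obtain ⟨ξ, rfl⟩ := QuotientAddGroup.mk_surjective α
  have hn : 1 ≤ n := by
    by_contra! hn
    obtain rfl : n = 0 := by omega
    simp [ReturnsCloser, returnDist] at h
  obtain ⟨j, hj1, hjn, hj⟩ := exists_norm_nsmul_eq_returnDist (α := (ξ : UnitAddCircle)) hn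
  obtain ⟨p, hp⟩ := exists_int_norm_nsmul_coe_eq ξ j
  obtain ⟨q, hq⟩ := exists_int_norm_nsmul_coe_eq ξ (n + 1)
  have hlt : |((n + 1 : ℕ) : ℝ) * ξ - q| < |j * ξ - p| := by
    rw [← hp, ← hq, hj]; exact h
  have := one_le_two_mul_mul_abs_sub hj1 (hjn.trans n.le_succ) hlt
  rw [← hp, hj] at this
  push_cast at this
  linarith

theorem returnDist_pos {n : ℕ} (hα : addOrderOf α = 0) (hn : 1 ≤ n) : 0 < returnDist α n := by
  obtain ⟨j, hj, -, h⟩ := exists_norm_nsmul_eq_returnDist (α := α) hn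
  rw [← h, norm_pos_iff]
  exact addOrderOf_eq_zero_iff'.1 hα j hj

theorem frequently_returnsCloser (hα : addOrderOf α = 0) :
    ∃ᶠ n in atTop, ReturnsCloser α n := by
  refine frequently_atTop.2 fun l => ?_
  have hl : 0 < returnDist α (l + 1) := returnDist_pos hα l.succ_pos
  obtain ⟨N, hN⟩ := exists_nat_gt (returnDist α (l + 1))⁻¹
  have hN0 : 0 < N := by
    have := (inv_pos.2 hl).trans hN
    exact_mod_cast this
  obtain ⟨j, hj, hjN⟩ := AddCircle.exists_norm_nsmul_le α hN0
  rw [mem_Icc] at hj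
  have hlt : ‖j • α‖ < returnDist α (l + 1) := by
    refine hjN.trans_lt ?_
    rw [div_lt_iff₀ (by positivity), mul_comm]
    rw [inv_lt_iff_one_lt_mul₀ hl] at hN
    push_cast
    linarith
  have hdist := returnDist_le_norm_nsmul (α := α) hj.1 le_rfl
  have hlj : l + 1 ≤ j := by
    by_contra! hj'
    exact hlt.not_ge (returnDist_le_norm_nsmul hj.1 hj'.le)
  rcases returnDist_eq_or_exists_returnsCloser (α := α) hlj with h | ⟨n, hln, -, hn, -⟩
  · exact absurd h (hdist.trans_lt hlt).ne
  · exact ⟨n, by omega, hn⟩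

end ClosestReturn

section Arc

variable {T : ℝ} [hT : Fact (0 < T)]

theorem volume_ball_addCircle (x : AddCircle T) (ρ : ℝ) :
    volume (ball x ρ) = ENNReal.ofReal (min T (2 * ρ)) := by
  rw [← measure_congr AddCircle.closedBall_ae_eq_ball, AddCircle.volume_closedBall]

theorem volume_ball_addCircle_le (x : AddCircle T) (ρ : ℝ) :
    volume (ball x ρ) ≤ ENNReal.ofReal (2 * ρ) := by
  rw [volume_ball_addCircle]
  exact ENNReal.ofReal_le_ofReal (min_le_right _ _)

theorem volume_ball_sdiff_ball_le {x y : AddCircle T} {ρ ρ' : ℝ} (hρ : 0 ≤ ρ) (h : ρ ≤ ρ') :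
    volume (ball x ρ \ ball y ρ') ≤ ENNReal.ofReal (2 * min ρ (dist x y)) := by
  set r := ρ - min ρ (dist x y) with hr
  have hr0 : 0 ≤ r := sub_nonneg.2 (min_le_left _ _)
  have hsub : ball x r ⊆ ball y ρ' := by
    rcases le_total ρ (dist x y) with hd | hd
    · simp [hr, hd]
    · refine ball_subset_ball' ?_
      rw [hr, min_eq_right hd]
      linarith
  have hrρ : r ≤ ρ := sub_le_self _ (le_min hρ dist_nonneg)
  calc volume (ball x ρ \ ball y ρ')
      ≤ volume (ball x ρ \ ball x r) := measure_mono (sdiff_subset_sdiff_right hsub)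
    _ = ENNReal.ofReal (min T (2 * ρ) - min T (2 * r)) := by
      rw [measure_sdiff (ball_subset_ball hrρ) measurableSet_ball.nullMeasurableSet
        (measure_ne_top _ _), volume_ball_addCircle, volume_ball_addCircle,
        ENNReal.ofReal_sub _ (le_min hT.out.le (by positivity))]
    _ ≤ ENNReal.ofReal (2 * min ρ (dist x y)) := by
      refine ENNReal.ofReal_le_ofReal ?_
      have : 2 * min ρ (dist x y) = 2 * ρ - 2 * r := by rw [hr]; ring
      rw [this]
      rcases le_total T (2 * r) with h1 | h1
      · rw [min_eq_left h1, min_eq_left (h1.trans (by linarith))]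
        linarith
      · rw [min_eq_right h1]
        linarith [min_le_right T (2 * ρ)]

end Arc

section Convergence

/-- The points that are within `ψ n` of `n • α` for infinitely many `n`. -/
def approxSet {E : Type*} [SeminormedAddCommGroup E] (ψ : ℕ → ℝ) (α : E) : Set E :=
  limsup (fun n => ball (n • α) (ψ n)) atTop

/-- Olivier's theorem: `n f(n)` is at most twice the sum of `f` over `[n / 2, n)`. -/
theorem tendsto_natCast_mul_of_antitone_of_summable {f : ℕ → ℝ} (hf : Antitone f)
    (hsum : Summable f) : Tendsto (fun n : ℕ => n * f n) atTop (𝓝 0) := by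
  have hf0 : ∀ n, 0 ≤ f n := fun n => hf.le_of_tendsto hsum.tendsto_atTop_zero n
  have htail : Tendsto (fun n : ℕ => 2 * ∑' i, f (i + n / 2)) atTop (𝓝 0) := by
    simpa using ((tendsto_sum_nat_add f).comp
      (Nat.tendsto_div_const_atTop two_ne_zero)).const_mul 2
  refine squeeze_zero (fun n => mul_nonneg n.cast_nonneg (hf0 n)) (fun n => ?_) htail
  have hblock : (n - n / 2 : ℕ) * f n ≤ ∑' i, f (i + n / 2) :=
    calc ((n - n / 2 : ℕ) : ℝ) * f n
        = ∑ _ ∈ Finset.range (n - n / 2), f n := by simp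
      _ ≤ ∑ i ∈ Finset.range (n - n / 2), f (i + n / 2) :=
        Finset.sum_le_sum fun _ hi => hf (by have := Finset.mem_range.1 hi; omega)
      _ ≤ ∑' i, f (i + n / 2) :=
        ((summable_nat_add_iff _).2 hsum).sum_le_tsum _ fun i _ => hf0 _
  have hhalf : (n : ℝ) ≤ 2 * (n - n / 2 : ℕ) := by exact_mod_cast (by omega : n ≤ 2 * (n - n / 2))
  have := mul_le_mul_of_nonneg_right hhalf (hf0 n)
  linarith

variable {α : UnitAddCircle} {ψ : ℕ → ℝ}

/-- The arc at time `a + t` is compared with the one at time `a + t - j`, where `j ≤ t` is the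
closest return time, so that the centres are `returnDist α t` apart. -/
theorem volume_ball_sdiff_biUnion_le (hψ : Antitone ψ) (hψ0 : 0 ≤ ψ) (a : ℕ) {t : ℕ}
    (ht : 1 ≤ t) :
    volume (ball ((a + t) • α) (ψ (a + t)) \ ⋃ k < t, ball ((a + k) • α) (ψ (a + k))) ≤
      ENNReal.ofReal (2 * returnWeight ψ α t) := by
  obtain ⟨j, hj, hjt, hjα⟩ := exists_norm_nsmul_eq_returnDist (α := α) ht
  have hdist : dist ((a + t) • α) ((a + (t - j)) • α) = returnDist α t := by
    rw [dist_nsmul_nsmul (by omega), ← hjα]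
    congr 2
    omega
  calc _ ≤ volume (ball ((a + t) • α) (ψ (a + t)) \ ball ((a + (t - j)) • α) (ψ (a + (t - j)))) :=
        measure_mono <| sdiff_subset_sdiff_right <|
          subset_biUnion_of_mem (u := fun k => ball ((a + k) • α) (ψ (a + k)))
            (show t - j < t by omega)
    _ ≤ ENNReal.ofReal (2 * min (ψ (a + t)) (returnDist α t)) :=
        hdist ▸ volume_ball_sdiff_ball_le (hψ0 _) (hψ (by omega))
    _ ≤ ENNReal.ofReal (2 * returnWeight ψ α t) := by
        refine ENNReal.ofReal_le_ofReal ?_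
        have := min_le_min_right (returnDist α t) (hψ (Nat.le_add_left t a))
        unfold returnWeight
        linarith

theorem volume_iUnion_ball_le (hψ : Antitone ψ) (hψ0 : 0 ≤ ψ) {a : ℕ} (ha : 1 ≤ a) :
    volume (⋃ i, ball ((a + i) • α) (ψ (a + i))) ≤
      a * ENNReal.ofReal (2 * ψ a) + ∑' i, ENNReal.ofReal (2 * returnWeight ψ α (i + a)) := by
  set B : ℕ → Set UnitAddCircle := fun i => ball ((a + i) • α) (ψ (a + i))
  have hhead : ∀ i, volume (disjointed B i) ≤ ENNReal.ofReal (2 * ψ a) := fun i =>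
    (measure_mono (disjointed_subset B i)).trans <| (volume_ball_addCircle_le _ _).trans <|
      ENNReal.ofReal_le_ofReal (by linarith [hψ (Nat.le_add_right a i)])
  have htail : ∀ i, volume (disjointed B (i + a)) ≤
      ENNReal.ofReal (2 * returnWeight ψ α (i + a)) := fun i => by
    rw [disjointed_eq_inter_compl, ← compl_iUnion₂, ← sdiff_eq]
    exact volume_ball_sdiff_biUnion_le hψ hψ0 a (by omega)
  calc volume (⋃ i, B i) ≤ ∑' i, volume (disjointed B i) := by
        rw [← iUnion_disjointed]
        exact measure_iUnion_le _
    _ = ∑ i ∈ Finset.range a, volume (disjointed B i) + ∑' i, volume (disjointed B (i + a)) :=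
        (ENNReal.summable.sum_add_tsum_nat_add' (k := a)).symm
    _ ≤ _ := add_le_add
        ((Finset.sum_le_card_nsmul _ _ _ fun i _ => hhead i).trans_eq (by simp))
        (ENNReal.tsum_le_tsum htail)

theorem frequently_returnWeight_eq (hα : addOrderOf α = 0) (hψ : Antitone ψ)
    (hsum : Summable (returnWeight ψ α)) : ∃ᶠ n in atTop, returnWeight ψ α n = ψ n := by
  have hlim : Tendsto (fun n : ℕ => n * returnWeight ψ α n + returnWeight ψ α n) atTop (𝓝 0) := by
    simpa using (tendsto_natCast_mul_of_antitone_of_summable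
      (returnWeight_antitone hψ) hsum).add hsum.tendsto_atTop_zero
  refine ((frequently_returnsCloser hα).and_eventually
    (hlim.eventually_lt_const one_half_pos)).mono fun n ⟨hn, hlt⟩ => min_eq_left ?_
  by_contra! h
  rw [returnWeight, min_eq_right h.le] at hlt
  linarith [hn.half_le]

theorem volume_approxSet_eq_zero (hα : addOrderOf α = 0) (hψ : Antitone ψ) (hψ0 : 0 ≤ ψ)
    (hsum : Summable (returnWeight ψ α)) :
    volume (approxSet ψ α) = 0 := by
  have hhead : Tendsto (fun a : ℕ => a * ENNReal.ofReal (2 * returnWeight ψ α a)) atTop (𝓝 0) := by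
    have := (tendsto_natCast_mul_of_antitone_of_summable
      (returnWeight_antitone hψ) hsum).const_mul 2
    rw [mul_zero] at this
    refine (ENNReal.ofReal_zero ▸ ENNReal.tendsto_ofReal this).congr fun a => ?_
    rw [mul_left_comm, ENNReal.ofReal_mul a.cast_nonneg, ENNReal.ofReal_natCast]
  have htail := ENNReal.tendsto_sum_nat_add (fun i => ENNReal.ofReal (2 * returnWeight ψ α i))
    (hsum.mul_left 2).tsum_ofReal_ne_top
  refine nonpos_iff_eq_zero.1 (ge_of_tendsto_of_frequently (add_zero (0 : ENNReal) ▸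
    hhead.add htail) ?_)
  refine ((frequently_returnWeight_eq hα hψ hsum).and_eventually
    (eventually_ge_atTop 1)).mono fun a ⟨ha, ha1⟩ => ?_
  refine (measure_mono ?_).trans (ha ▸ volume_iUnion_ball_le hψ hψ0 ha1)
  rw [approxSet, limsup_eq_iInf_iSup_of_nat']
  refine (iInf_le _ a).trans_eq ?_
  simp only [iSup_eq_iUnion, add_comm]

end Convergence

section KochenStone

variable {Ω : Type*} [MeasurableSpace Ω] {μ : Measure Ω} [IsFiniteMeasure μ]

/-- The Chung–Erdős inequality: Cauchy–Schwarz in `L²` for the sum of the indicators of the `A i`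
and the indicator of their union. -/
theorem sq_sum_measureReal_le {ι : Type*} (s : Finset ι) {A : ι → Set Ω}
    (hA : ∀ i, MeasurableSet (A i)) :
    (∑ i ∈ s, μ.real (A i)) ^ 2 ≤
      μ.real (⋃ i ∈ s, A i) * ∑ i ∈ s, ∑ j ∈ s, μ.real (A i ∩ A j) := by
  have hU : MeasurableSet (⋃ i ∈ s, A i) := s.measurableSet_biUnion fun i _ => hA i
  have hinter : ∀ i ∈ s, (⋃ j ∈ s, A j) ∩ A i = A i := fun i hi =>
    inter_eq_self_of_subset_right (subset_biUnion_of_mem (u := A) hi)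
  have := real_inner_mul_inner_self_le
    (indicatorConstLp 2 hU (measure_ne_top μ _) (1 : ℝ))
    (∑ i ∈ s, indicatorConstLp 2 (hA i) (measure_ne_top μ _) (1 : ℝ))
  simp only [inner_sum, sum_inner, L2.real_inner_indicatorConstLp_one_indicatorConstLp_one,
    inter_self] at this
  rw [Finset.sum_congr rfl fun i hi => by rw [hinter i hi], Finset.sum_comm] at this
  rwa [sq]

theorem one_div_four_le_mul_measureReal_iUnion {A : ℕ → Set Ω} (hA : ∀ n, MeasurableSet (A n))
    (hsum : ¬ Summable fun n => μ.real (A n)) {C : ℝ}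
    (hC : ∀ᶠ N in atTop, ∑ n ∈ Finset.range N, ∑ m ∈ Finset.range N, μ.real (A n ∩ A m) ≤
      C * (∑ n ∈ Finset.range N, μ.real (A n)) ^ 2) (M : ℕ) :
    1 / 4 ≤ C * μ.real (⋃ i, A (i + M)) := by
  set S : ℕ → ℝ := fun N => ∑ n ∈ Finset.range N, μ.real (A n)
  have hdiv : Tendsto S atTop atTop :=
    (not_summable_iff_tendsto_nat_atTop_of_nonneg fun _ => measureReal_nonneg).1 hsum
  obtain ⟨N, ⟨hNC, hNS⟩, hN0, hMN⟩ := ((hC.and (hdiv.eventually_ge_atTop (2 * S M))).and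
    ((hdiv.eventually_gt_atTop 0).and (eventually_ge_atTop M))).exists
  have hhalf : S N / 2 ≤ ∑ n ∈ Finset.Ico M N, μ.real (A n) := by
    rw [Finset.sum_Ico_eq_sub _ hMN]
    linarith
  have hunion : ⋃ n ∈ Finset.Ico M N, A n ⊆ ⋃ i, A (i + M) := by
    refine iUnion₂_subset fun n hn => ?_
    rw [← Nat.sub_add_cancel (Finset.mem_Ico.1 hn).1]
    exact subset_iUnion (fun i => A (i + M)) _
  have hpairs : ∑ n ∈ Finset.Ico M N, ∑ m ∈ Finset.Ico M N, μ.real (A n ∩ A m) ≤ C * S N ^ 2 := by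
    have hIco : Finset.Ico M N ⊆ Finset.range N := fun n hn => by simp_all
    refine le_trans ?_ hNC
    exact (Finset.sum_le_sum fun _ _ => Finset.sum_le_sum_of_subset_of_nonneg hIco
      fun _ _ _ => measureReal_nonneg).trans <|
      Finset.sum_le_sum_of_subset_of_nonneg hIco
        fun _ _ _ => Finset.sum_nonneg fun _ _ => measureReal_nonneg
  have hquad : (S N / 2) ^ 2 ≤ μ.real (⋃ i, A (i + M)) * (C * S N ^ 2) :=
    calc (S N / 2) ^ 2 ≤ (∑ n ∈ Finset.Ico M N, μ.real (A n)) ^ 2 :=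
          pow_le_pow_left₀ (by positivity) hhalf 2
      _ ≤ _ := sq_sum_measureReal_le _ hA
      _ ≤ _ := mul_le_mul (measureReal_mono hunion) hpairs
          (Finset.sum_nonneg fun _ _ => Finset.sum_nonneg fun _ _ => measureReal_nonneg)
          measureReal_nonneg
  refine le_of_mul_le_mul_right ?_ (pow_pos hN0 2)
  linarith

/-- A form of the Kochen–Stone lemma. -/
theorem measure_limsup_ne_zero_of_sum_inter_le {A : ℕ → Set Ω} (hA : ∀ n, MeasurableSet (A n))
    (hsum : ¬ Summable fun n => μ.real (A n)) {C : ℝ}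
    (hC : ∀ᶠ N in atTop, ∑ n ∈ Finset.range N, ∑ m ∈ Finset.range N, μ.real (A n ∩ A m) ≤
      C * (∑ n ∈ Finset.range N, μ.real (A n)) ^ 2) :
    μ (limsup A atTop) ≠ 0 := by
  intro h0
  rw [limsup_eq_iInf_iSup_of_nat'] at h0
  simp only [iSup_eq_iUnion, iInf_eq_iInter] at h0
  have hanti : Antitone fun M => ⋃ i, A (i + M) := fun M M' h =>
    iUnion_subset fun i => by
      rw [show i + M' = i + (M' - M) + M by omega]
      exact subset_iUnion (fun i => A (i + M)) _
  have hlim := tendsto_measure_iInter_atTop (μ := μ)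
    (fun M => (MeasurableSet.iUnion fun i => hA (i + M)).nullMeasurableSet) hanti
    ⟨0, measure_ne_top _ _⟩
  rw [h0] at hlim
  have hlim' := ((ENNReal.tendsto_toReal ENNReal.zero_ne_top).comp hlim).const_mul C
  rw [ENNReal.toReal_zero, mul_zero] at hlim'
  have := ge_of_tendsto' hlim' (one_div_four_le_mul_measureReal_iUnion hA hsum hC)
  norm_num at this

end KochenStone

section Counting

/-- Each `g m` is spread over the `L` preceding indices, where `g` is at least as large. -/
theorem mul_sum_filter_le_of_antitone {g : ℕ → ℝ} (hg : Antitone g) (hg0 : 0 ≤ g)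
    (p : ℕ → Prop) [DecidablePred p] {L N : ℕ} {c : ℝ}
    (hc : ∀ t, ({m ∈ Finset.Ioc t (t + L) | p m}.card : ℝ) ≤ c) :
    L * ∑ m ∈ Finset.Ico L N with p m, g m ≤ c * ∑ t ∈ Finset.range N, g t := by
  have hspread : ∀ m ∈ {m ∈ Finset.Ico L N | p m}, L * g m ≤ ∑ t ∈ Finset.Ico (m - L) m, g t := by
    intro m hm
    have hLm : L ≤ m := (Finset.mem_Ico.1 (Finset.mem_filter.1 hm).1).1
    have := Finset.card_nsmul_le_sum (Finset.Ico (m - L) m) g (g m)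
      fun t ht => hg (Finset.mem_Ico.1 ht).2.le
    rwa [Nat.card_Ico, Nat.sub_sub_self hLm, nsmul_eq_mul] at this
  calc L * ∑ m ∈ Finset.Ico L N with p m, g m
      ≤ ∑ m ∈ Finset.Ico L N with p m, ∑ t ∈ Finset.Ico (m - L) m, g t := by
        rw [Finset.mul_sum]
        exact Finset.sum_le_sum hspread
    _ = ∑ t ∈ Finset.range N, ∑ m ∈ Finset.Ico L N with p m ∧ t < m ∧ m ≤ t + L, g t :=
        Finset.sum_comm' fun m t => by
          simp only [Finset.mem_filter, Finset.mem_Ico, Finset.mem_range]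
          grind
    _ ≤ ∑ t ∈ Finset.range N, c * g t := by
        refine Finset.sum_le_sum fun t _ => ?_
        rw [Finset.sum_const, nsmul_eq_mul]
        refine mul_le_mul_of_nonneg_right (le_trans ?_ (hc t)) (hg0 t)
        refine Nat.cast_le.2 (Finset.card_le_card fun m hm => ?_)
        simp only [Finset.mem_filter, Finset.mem_Ioc] at hm ⊢
        tauto
    _ = c * ∑ t ∈ Finset.range N, g t := (Finset.mul_sum _ _ _).symm

theorem card_mul_le_of_separated {T : ℝ} [hT : Fact (0 < T)] {ι : Type*} {s : Finset ι}
    {u : ι → AddCircle T} {x : AddCircle T} {D ρ : ℝ} (hD : D ≤ T)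
    (hsep : (s : Set ι).Pairwise fun i j => D ≤ dist (u i) (u j))
    (hmem : ∀ i ∈ s, dist (u i) x ≤ ρ) (hρ : 0 ≤ 2 * ρ + D) :
    s.card * D ≤ 2 * ρ + D := by
  have hdisj : (s : Set ι).PairwiseDisjoint fun i => ball (u i) (D / 2) := fun i hi j hj hij =>
    ball_disjoint_ball (by linarith [hsep hi hj hij])
  have hsub : ⋃ i ∈ s, ball (u i) (D / 2) ⊆ ball x (ρ + D / 2) :=
    iUnion₂_subset fun i hi => ball_subset_ball' (by linarith [hmem i hi])
  have hvol : ∀ (y : AddCircle T) (r : ℝ),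
      (volume : Measure (AddCircle T)).real (ball y r) = max (min T (2 * r)) 0 := fun y r => by
    rw [measureReal_def, volume_ball_addCircle, ENNReal.toReal_ofReal']
  have := measureReal_mono (μ := volume) hsub
  rw [measureReal_biUnion_finset hdisj fun _ _ => measurableSet_ball, hvol] at this
  simp only [hvol, Finset.sum_const, nsmul_eq_mul, mul_div_cancel₀ D two_ne_zero,
    min_eq_right hD, mul_add] at this
  exact (mul_le_mul_of_nonneg_left (le_max_left _ _) s.card.cast_nonneg).trans
    (this.trans (max_le (min_le_right _ _) hρ))

theorem sum_range_sum_range_of_symm {f : ℕ → ℕ → ℝ} (hf : ∀ i j, f i j = f j i) (N : ℕ) :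
    ∑ i ∈ Finset.range N, ∑ j ∈ Finset.range N, f i j =
      ∑ i ∈ Finset.range N, f i i + 2 * ∑ j ∈ Finset.range N, ∑ i ∈ Finset.range j, f i j := by
  induction N with
  | zero => simp
  | succ N ih =>
    simp only [Finset.sum_range_succ, Finset.sum_add_distrib, ih, hf N]
    ring

end Counting

section Divergence

/-- The orbit comes at distance at most `w` from its starting point, at a closest return that is
followed by another one up to time `m`. -/
def ReturnsWithin (α : UnitAddCircle) (w : ℝ) (m : ℕ) : Prop :=
  ∃ L < m, ReturnsCloser α L ∧ returnDist α L ≤ w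

/-- The arc around `n • α` of total length half the `n`-th weight. -/
def weightArc (ψ : ℕ → ℝ) (α : UnitAddCircle) (n : ℕ) : Set UnitAddCircle :=
  ball (n • α) (returnWeight ψ α n / 4)

/-- The necessary condition `‖(m - n) • α‖ < returnWeight ψ α n / 2` for the arcs at times
`n < m` to meet. -/
def OrbitHits (ψ : ℕ → ℝ) (α : UnitAddCircle) (n m : ℕ) : Prop :=
  dist (m • α) (n • α) < returnWeight ψ α n / 2

variable {α : UnitAddCircle} {ψ : ℕ → ℝ}

theorem returnDist_le_half (n : ℕ) : returnDist α n ≤ 1 / 2 := by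
  have := (returnDist_antitone n.zero_le).trans
    (AddCircle.norm_le_half_period 1 one_ne_zero (x := α))
  simpa using this

theorem measureReal_weightArc (hψ0 : 0 ≤ ψ) (n : ℕ) :
    volume.real (weightArc ψ α n) = returnWeight ψ α n / 2 := by
  have h0 : 0 ≤ returnWeight ψ α n := returnWeight_nonneg hψ0 n
  have h1 : returnWeight ψ α n ≤ 1 / 2 := (min_le_right _ _).trans (returnDist_le_half n)
  rw [weightArc, measureReal_def, volume_ball_addCircle, min_eq_right (by linarith),
    ENNReal.toReal_ofReal (by linarith)]
  ring

open scoped Classical in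
theorem measureReal_weightArc_inter_le (hψ : Antitone ψ) (hψ0 : 0 ≤ ψ) {n m : ℕ} (hnm : n ≤ m) :
    volume.real (weightArc ψ α n ∩ weightArc ψ α m) ≤
      if OrbitHits ψ α n m then returnWeight ψ α m / 2 else 0 := by
  split_ifs with hhit
  · exact (measureReal_mono inter_subset_right).trans_eq (measureReal_weightArc hψ0 m)
  · have hdisj : Disjoint (weightArc ψ α n) (weightArc ψ α m) := by
      refine ball_disjoint_ball ?_
      have := returnWeight_antitone (α := α) hψ hnm
      rw [OrbitHits, not_lt, dist_comm] at hhit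
      linarith
    simp [hdisj.inter_eq]

open scoped Classical in
/-- The hits in a window of length `L + 1` are `returnDist α L`-separated points of an arc of
length `returnWeight ψ α n`. -/
theorem card_orbitHits_le {n L : ℕ} (hL : ReturnsCloser α L)
    (hLn : returnDist α L ≤ returnWeight ψ α n) (t : ℕ) :
    ({m ∈ Finset.Ioc t (t + (L + 1)) | n < m ∧ OrbitHits ψ α n m}.card : ℝ) ≤
      (L + 1) * (4 * returnWeight ψ α n) := by
  set s := {m ∈ Finset.Ioc t (t + (L + 1)) | n < m ∧ OrbitHits ψ α n m} with hs
  have hδ0 : 0 ≤ returnDist α L := returnDist_nonneg L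
  have hlt : ∀ i ∈ s, ∀ j ∈ s, i < j → returnDist α L ≤ dist (j • α) (i • α) := by
    intro i hi j hj hij
    rw [hs, Finset.mem_filter, Finset.mem_Ioc] at hi hj
    rw [dist_nsmul_nsmul hij.le]
    exact returnDist_le_norm_nsmul (by omega) (by omega)
  have hsep : (s : Set ℕ).Pairwise fun i j => returnDist α L ≤ dist (i • α) (j • α) := by
    intro i hi j hj hij
    rcases hij.lt_or_gt with h | h
    · rw [dist_comm]
      exact hlt i hi j hj h
    · exact hlt j hj i hi h
  have hpack := card_mul_le_of_separated (x := n • α) (ρ := returnWeight ψ α n / 2)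
    (by linarith [returnDist_le_half (α := α) L]) hsep
    (fun m hm => (Finset.mem_filter.1 hm).2.2.le) (by linarith)
  calc (s.card : ℝ) ≤ s.card * (2 * ((L + 1) * returnDist α L)) :=
        le_mul_of_one_le_right s.card.cast_nonneg (by linarith [hL.half_le])
    _ = 2 * (L + 1) * (s.card * returnDist α L) := by ring
    _ ≤ 2 * (L + 1) * (2 * returnWeight ψ α n) :=
        mul_le_mul_of_nonneg_left (by linarith) (by positivity)
    _ = (L + 1) * (4 * returnWeight ψ α n) := by ring

open scoped Classical in
theorem sum_orbitHits_returnsWithin_le (hψ : Antitone ψ) (hψ0 : 0 ≤ ψ) (n N : ℕ) :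
    ∑ m ∈ Finset.Ico (n + 1) N with
        OrbitHits ψ α n m ∧ ReturnsWithin α (returnWeight ψ α n) m, returnWeight ψ α m ≤
      4 * returnWeight ψ α n * ∑ t ∈ Finset.range N, returnWeight ψ α t := by
  have hg0 : ∀ m, 0 ≤ returnWeight ψ α m := returnWeight_nonneg hψ0
  by_cases hex : ∃ L, ReturnsCloser α L ∧ returnDist α L ≤ returnWeight ψ α n
  · set L := Nat.find hex
    obtain ⟨hL, hLn⟩ := Nat.find_spec hex
    have hsub : {m ∈ Finset.Ico (n + 1) N | OrbitHits ψ α n m ∧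
        ReturnsWithin α (returnWeight ψ α n) m} ⊆
        {m ∈ Finset.Ico (L + 1) N | n < m ∧ OrbitHits ψ α n m} := by
      intro m hm
      simp only [Finset.mem_filter, Finset.mem_Ico] at hm ⊢
      obtain ⟨⟨hnm, hmN⟩, hhit, K, hKm, hK⟩ := hm
      have hLK : L ≤ K := Nat.find_min' hex hK
      exact ⟨⟨by omega, hmN⟩, by omega, hhit⟩
    have hwindow := mul_sum_filter_le_of_antitone (N := N) (returnWeight_antitone (α := α) hψ) hg0
      (fun m => n < m ∧ OrbitHits ψ α n m) (card_orbitHits_le hL hLn)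
    push_cast at hwindow
    refine (Finset.sum_le_sum_of_subset_of_nonneg hsub fun m _ _ => hg0 m).trans ?_
    refine le_of_mul_le_mul_left (hwindow.trans_eq ?_) (by positivity : (0 : ℝ) < L + 1)
    ring
  · rw [Finset.filter_false_of_mem fun m _ ⟨_, K, _, hK⟩ => hex ⟨K, hK⟩, Finset.sum_empty]
    exact mul_nonneg (mul_nonneg zero_le_four (hg0 n)) (Finset.sum_nonneg fun t _ => hg0 t)

theorem OrbitHits.norm_lt {n m : ℕ} (h : OrbitHits ψ α n m) (hnm : n ≤ m) :
    ‖(m - n) • α‖ < returnWeight ψ α n / 2 :=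
  dist_nsmul_nsmul (α := α) hnm ▸ h

/-- If the arc at time `m` is hit by those at times `n < l`, the return of the orbit from `n` to
`l` provides the scale that the earlier hit needs. -/
theorem OrbitHits.returnsWithin_of_lt (hψ : Antitone ψ) {n l m : ℕ} (hnl : n < l) (hlm : l < m)
    (hn : OrbitHits ψ α n m) (hl : OrbitHits ψ α l m) :
    ReturnsWithin α (returnWeight ψ α n) m := by
  have hlδ : returnWeight ψ α l ≤ returnDist α l := min_le_right _ _
  have hlast : ‖(m - l) • α‖ < returnDist α l := by
    linarith [hl.norm_lt hlm.le, norm_nonneg ((m - l) • α)]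
  have hld : l ≤ m - l := by
    by_contra! hd
    exact hlast.not_ge (returnDist_le_norm_nsmul (by omega) hd.le)
  rcases returnDist_eq_or_exists_returnsCloser (α := α) hld with heq | ⟨L, -, hLm, hL, heq⟩
  · exact absurd ((returnDist_le_norm_nsmul (by omega) le_rfl).trans_lt hlast) heq.not_lt
  · refine ⟨L, by omega, hL, ?_⟩
    calc returnDist α L = returnDist α l := heq
      _ ≤ ‖(l - n) • α‖ := returnDist_le_norm_nsmul (by omega) (by omega)
      _ = dist (l • α) (n • α) := (dist_nsmul_nsmul hnl.le).symm
      _ ≤ dist (m • α) (l • α) + dist (m • α) (n • α) := dist_triangle_left _ _ _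
      _ ≤ returnWeight ψ α l / 2 + returnWeight ψ α n / 2 := add_le_add hl.le hn.le
      _ ≤ returnWeight ψ α n := by linarith [returnWeight_antitone (α := α) hψ hnl.le]

open scoped Classical in
theorem card_orbitHits_not_returnsWithin_le_one (hψ : Antitone ψ) (m : ℕ) :
    {n ∈ Finset.range m | OrbitHits ψ α n m ∧ ¬ ReturnsWithin α (returnWeight ψ α n) m}.card ≤
      1 := by
  refine Finset.card_le_one.2 fun n hn l hl => ?_
  simp only [Finset.mem_filter, Finset.mem_range] at hn hl
  obtain ⟨hnm, hn, hn'⟩ := hn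
  obtain ⟨hlm, hl, hl'⟩ := hl
  by_contra! hne
  rcases hne.lt_or_gt with h | h
  · exact hn' (hn.returnsWithin_of_lt hψ h hlm hl)
  · exact hl' (hl.returnsWithin_of_lt hψ h hnm hn)

open scoped Classical in
theorem sum_sum_orbitHits_le (hψ : Antitone ψ) (hψ0 : 0 ≤ ψ) (N : ℕ) :
    ∑ m ∈ Finset.range N, ∑ n ∈ Finset.range m with OrbitHits ψ α n m, returnWeight ψ α m ≤
      4 * (∑ n ∈ Finset.range N, returnWeight ψ α n) ^ 2 +
        ∑ n ∈ Finset.range N, returnWeight ψ α n := by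
  have hwithin : ∑ m ∈ Finset.range N, ∑ n ∈ Finset.range m with
      OrbitHits ψ α n m ∧ ReturnsWithin α (returnWeight ψ α n) m, returnWeight ψ α m ≤
      4 * (∑ n ∈ Finset.range N, returnWeight ψ α n) ^ 2 := by
    simp only [Finset.sum_filter, Finset.range_eq_Ico]
    rw [← Finset.sum_Ico_Ico_comm', sq, Finset.sum_mul, Finset.mul_sum]
    refine Finset.sum_le_sum fun n _ => ?_
    rw [← Finset.sum_filter, ← Finset.range_eq_Ico, ← mul_assoc]
    exact sum_orbitHits_returnsWithin_le hψ hψ0 n N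
  have hlast : ∑ m ∈ Finset.range N, ∑ n ∈ Finset.range m with
      OrbitHits ψ α n m ∧ ¬ ReturnsWithin α (returnWeight ψ α n) m, returnWeight ψ α m ≤
      ∑ n ∈ Finset.range N, returnWeight ψ α n := by
    refine Finset.sum_le_sum fun m _ => ?_
    rw [Finset.sum_const, nsmul_eq_mul]
    exact mul_le_of_le_one_left (returnWeight_nonneg hψ0 m)
      (Nat.cast_le_one.2 (card_orbitHits_not_returnsWithin_le_one hψ m))
  refine le_trans (le_of_eq ?_) (add_le_add hwithin hlast)
  rw [← Finset.sum_add_distrib]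
  refine Finset.sum_congr rfl fun m _ => ?_
  rw [← Finset.filter_filter, ← Finset.filter_filter, Finset.sum_filter_add_sum_filter_not]

theorem sum_sum_measureReal_weightArc_inter_le (hψ : Antitone ψ) (hψ0 : 0 ≤ ψ) (N : ℕ) :
    ∑ n ∈ Finset.range N, ∑ m ∈ Finset.range N,
        volume.real (weightArc ψ α n ∩ weightArc ψ α m) ≤
      16 * (∑ n ∈ Finset.range N, volume.real (weightArc ψ α n)) ^ 2 +
        3 * ∑ n ∈ Finset.range N, volume.real (weightArc ψ α n) := by
  classical
  have hpairs : ∑ m ∈ Finset.range N, ∑ n ∈ Finset.range m,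
      volume.real (weightArc ψ α n ∩ weightArc ψ α m) ≤
      (∑ m ∈ Finset.range N, ∑ n ∈ Finset.range m with OrbitHits ψ α n m,
        returnWeight ψ α m) / 2 := by
    simp only [Finset.sum_filter, Finset.sum_div, ite_div, zero_div]
    exact Finset.sum_le_sum fun m _ => Finset.sum_le_sum fun n hn =>
      measureReal_weightArc_inter_le hψ hψ0 (Finset.mem_range.1 hn).le
  rw [sum_range_sum_range_of_symm fun n m => by rw [inter_comm]]
  simp only [inter_self, measureReal_weightArc hψ0, ← Finset.sum_div]
  linarith [sum_sum_orbitHits_le (α := α) hψ hψ0 N]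

theorem volume_approxSet_ne_zero (hψ : Antitone ψ) (hψ0 : 0 ≤ ψ)
    (hsum : ¬ Summable (returnWeight ψ α)) :
    volume (approxSet ψ α) ≠ 0 := by
  have hdiv : ¬ Summable fun n => volume.real (weightArc ψ α n) := by
    simp only [measureReal_weightArc hψ0]
    exact fun h => hsum (by simpa using h.mul_right 2)
  have hpairs : ∀ᶠ N in atTop, ∑ n ∈ Finset.range N, ∑ m ∈ Finset.range N,
      volume.real (weightArc ψ α n ∩ weightArc ψ α m) ≤
      19 * (∑ n ∈ Finset.range N, volume.real (weightArc ψ α n)) ^ 2 := by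
    filter_upwards [((not_summable_iff_tendsto_nat_atTop_of_nonneg
      fun _ => measureReal_nonneg).1 hdiv).eventually_ge_atTop 1] with N hN
    linarith [sum_sum_measureReal_weightArc_inter_le (α := α) hψ hψ0 N, le_self_pow₀ hN two_ne_zero]
  have hsub : ∀ n, weightArc ψ α n ⊆ ball (n • α) (ψ n) := fun n => by
    refine ball_subset_ball ?_
    linarith [returnWeight_nonneg (α := α) hψ0 n, min_le_left (ψ n) (returnDist α n),
      show returnWeight ψ α n = min (ψ n) (returnDist α n) from rfl]
  exact fun h0 => measure_limsup_ne_zero_of_sum_inter_le (fun _ => measurableSet_ball) hdiv hpairs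
    (measure_mono_null (limsup_le_limsup (Eventually.of_forall hsub)) h0)

theorem approxSet_ae_eq_empty_or_univ (hα : addOrderOf α = 0) (hψ : Antitone ψ) :
    approxSet ψ α =ᵐ[volume] (∅ : Set UnitAddCircle) ∨ approxSet ψ α =ᵐ[volume] univ := by
  have hmeas : MeasurableSet (approxSet ψ α) :=
    MeasurableSet.measurableSet_limsup fun _ => measurableSet_ball
  have hsub : (· + α) ⁻¹' approxSet ψ α ⊆ approxSet ψ α := by
    intro x hx
    rw [mem_preimage, approxSet, mem_limsup_iff_frequently_mem] at hx
    rw [approxSet, mem_limsup_iff_frequently_mem]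
    refine (tendsto_sub_atTop_nat 1).frequently
      ((hx.and_eventually (eventually_ge_atTop 1)).mono fun n ⟨hxn, hn⟩ => ?_)
    obtain ⟨k, rfl⟩ := Nat.exists_eq_add_of_le' hn
    rw [mem_ball, succ_nsmul, dist_add_right] at hxn
    exact mem_ball.2 (hxn.trans_le (hψ k.le_succ))
  exact (AddCircle.ergodic_add_right.2 hα).ae_empty_or_univ_of_preimage_ae_le
    hmeas.nullMeasurableSet (Eventually.of_forall hsub)

theorem ae_mem_approxSet_iff (hα : addOrderOf α = 0) (hψ : Antitone ψ) (hψ0 : 0 ≤ ψ) :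
    ∀ᵐ x, x ∈ approxSet ψ α ↔ ¬ Summable (returnWeight ψ α) := by
  by_cases hsum : Summable (returnWeight ψ α)
  · filter_upwards [measure_eq_zero_iff_ae_notMem.1
      (volume_approxSet_eq_zero hα hψ hψ0 hsum)] with x hx
    exact iff_of_false hx (not_not.2 hsum)
  · have hfull := (approxSet_ae_eq_empty_or_univ hα hψ).resolve_left fun h0 =>
      volume_approxSet_ne_zero hψ hψ0 hsum (ae_eq_empty.1 h0)
    filter_upwards [eventuallyEq_univ.1 hfull] with x hx
    exact iff_of_true hx hsum

end Divergence

section Convergent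

theorem num_intCast_add (n : ℤ) (x : ℚ) : (n + x).num = n * x.den + x.num := by
  have h : ((n + x).num : ℚ) = n * x.den + x.num := by
    rw [← Rat.mul_den_eq_num, Rat.intCast_add_den, add_mul, Rat.mul_den_eq_num]
  exact_mod_cast h

theorem num_inv_of_pos {x : ℚ} (hx : 0 < x) : x⁻¹.num = x.den := by
  rw [Rat.num_inv, Int.sign_eq_one_of_pos (Rat.num_pos.2 hx), one_mul]

theorem den_inv_of_pos {x : ℚ} (hx : 0 < x) : (x⁻¹.den : ℤ) = x.num := by
  rw [Rat.den_inv_of_ne_zero hx.ne', Int.natAbs_of_nonneg (Rat.num_pos.2 hx).le]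

variable {ξ : ℝ}

theorem fract_pos_of_irrational (hξ : Irrational ξ) : 0 < Int.fract ξ :=
  Int.fract_pos.2 (hξ.ne_int _)

theorem irrational_inv_fract (hξ : Irrational ξ) : Irrational (Int.fract ξ)⁻¹ :=
  (hξ.sub_intCast ⌊ξ⌋).inv

theorem one_lt_inv_fract (hξ : Irrational ξ) : 1 < (Int.fract ξ)⁻¹ :=
  (one_lt_inv₀ (fract_pos_of_irrational hξ)).2 (Int.fract_lt_one ξ)

theorem one_le_floor_of_one_lt (h1 : 1 < ξ) : 1 ≤ ⌊ξ⌋ :=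
  Int.le_floor.2 (by exact_mod_cast h1.le)

theorem convergent_pos (n : ℕ) (hξ : Irrational ξ) (h1 : 1 < ξ) : 0 < ξ.convergent n := by
  have hfloor : (0 : ℚ) < ⌊ξ⌋ := Int.cast_pos.2 (one_le_floor_of_one_lt h1)
  induction n generalizing ξ with
  | zero => rwa [Real.convergent_zero]
  | succ n ih =>
    rw [Real.convergent_succ]
    have h1' := one_lt_inv_fract hξ
    exact add_pos hfloor (inv_pos.2 (ih (irrational_inv_fract hξ) h1'
      (Int.cast_pos.2 (one_le_floor_of_one_lt h1'))))

theorem convergentDen_zero (ξ : ℝ) : convergentDen ξ 0 = 1 := by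
  rw [convergentDen, Real.convergent_zero, Rat.den_intCast]

theorem convergentDen_succ (n : ℕ) (hξ : Irrational ξ) :
    (convergentDen ξ (n + 1) : ℤ) = ((Int.fract ξ)⁻¹.convergent n).num := by
  rw [convergentDen, Real.convergent_succ, Rat.intCast_add_den,
    den_inv_of_pos (convergent_pos n (irrational_inv_fract hξ) (one_lt_inv_fract hξ))]

theorem num_convergent_succ (n : ℕ) (hξ : Irrational ξ) :
    (ξ.convergent (n + 1)).num =
      ⌊ξ⌋ * ((Int.fract ξ)⁻¹.convergent n).num + convergentDen (Int.fract ξ)⁻¹ n := by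
  have hpos := convergent_pos n (irrational_inv_fract hξ) (one_lt_inv_fract hξ)
  rw [Real.convergent_succ, num_intCast_add, den_inv_of_pos hpos, num_inv_of_pos hpos,
    convergentDen]

theorem convergent_det (n : ℕ) (hξ : Irrational ξ) :
    (ξ.convergent (n + 1)).num * convergentDen ξ n -
      (ξ.convergent n).num * convergentDen ξ (n + 1) = (-1) ^ n := by
  induction n generalizing ξ with
  | zero =>
    rw [num_convergent_succ 0 hξ, convergentDen_succ 0 hξ]
    simp [convergentDen_zero]
  | succ n ih =>
    rw [num_convergent_succ (n + 1) hξ, convergentDen_succ (n + 1) hξ, num_convergent_succ n hξ,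
      convergentDen_succ n hξ, pow_succ, ← ih (irrational_inv_fract hξ)]
    ring

/-- The signed error `q_n ξ - p_n` of the `n`-th convergent `p_n / q_n`. -/
noncomputable def convergentError (ξ : ℝ) (n : ℕ) : ℝ :=
  convergentDen ξ n * ξ - (ξ.convergent n).num

theorem convergentError_succ (n : ℕ) (hξ : Irrational ξ) :
    convergentError ξ (n + 1) = -(Int.fract ξ * convergentError (Int.fract ξ)⁻¹ n) := by
  have hden : (convergentDen ξ (n + 1) : ℝ) = ((Int.fract ξ)⁻¹.convergent n).num := by
    exact_mod_cast convergentDen_succ n hξ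
  have hcancel := mul_inv_cancel₀ (fract_pos_of_irrational hξ).ne'
  rw [convergentError, convergentError, hden, num_convergent_succ n hξ]
  push_cast
  linear_combination ((Int.fract ξ)⁻¹.convergent n).num * Int.self_sub_floor ξ +
    (convergentDen (Int.fract ξ)⁻¹ n : ℝ) * hcancel

theorem convergentError_mul_succ_nonpos (n : ℕ) (hξ : Irrational ξ) :
    convergentError ξ n * convergentError ξ (n + 1) ≤ 0 := by
  have hfract := fract_pos_of_irrational hξ
  induction n generalizing ξ with
  | zero =>
    have herr : ∀ x : ℝ, convergentError x 0 = Int.fract x := fun x => by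
      simp [convergentError, convergentDen_zero, Int.self_sub_floor]
    rw [convergentError_succ 0 hξ, herr, herr, mul_neg, neg_nonpos]
    exact mul_nonneg hfract.le (mul_nonneg hfract.le (Int.fract_nonneg _))
  | succ n ih =>
    have hξ' := irrational_inv_fract hξ
    rw [convergentError_succ n hξ, convergentError_succ (n + 1) hξ, neg_mul_neg, mul_mul_mul_comm]
    exact mul_nonpos_of_nonneg_of_nonpos (mul_self_nonneg _) (ih hξ' (fract_pos_of_irrational hξ'))

/-- Two approximations with determinant `± 1` form a basis of `ℤ²`. In this basis, the
coordinates of an approximation `(j, p)` with `0 < j < Q'` have opposite signs, and so do the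
two errors, which therefore cannot cancel. -/
theorem abs_mul_sub_le_of_isUnit_det {P Q P' Q' j p : ℤ} (hdet : IsUnit (P' * Q - P * Q'))
    (herr : (Q * ξ - P) * (Q' * ξ - P') ≤ 0) (hQ : 0 < Q) (hj : 0 < j) (hjQ : j < Q') :
    |Q * ξ - P| ≤ |j * ξ - p| := by
  have hsq := Int.isUnit_mul_self hdet
  set u := P' * Q - P * Q' with hu
  obtain ⟨x, hx⟩ : ∃ x, x = u * (P' * j - Q' * p) := ⟨_, rfl⟩
  obtain ⟨y, hy⟩ : ∃ y, y = u * (Q * p - P * j) := ⟨_, rfl⟩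
  have hjxy : j = x * Q + y * Q' := by rw [hx, hy]; linear_combination -j * hsq + j * u * hu
  have hpxy : p = x * P + y * P' := by rw [hx, hy]; linear_combination -p * hsq + p * u * hu
  have hx0 : x ≠ 0 := by
    rintro rfl
    rcases le_or_gt y 0 with hy0 | hy0 <;> nlinarith
  have hxy : x * y ≤ 0 := by
    by_contra! hpos
    rcases pos_and_pos_or_neg_and_neg_of_mul_pos hpos with ⟨hx', hy'⟩ | ⟨hx', hy'⟩ <;> nlinarith
  have hsum : j * ξ - p = x * (Q * ξ - P) + y * (Q' * ξ - P') := by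
    rw [hjxy, hpxy]; push_cast; ring
  have hcross : 0 ≤ (x * (Q * ξ - P)) * (y * (Q' * ξ - P')) := by
    rw [mul_mul_mul_comm]
    exact mul_nonneg_of_nonpos_of_nonpos (by exact_mod_cast hxy) herr
  calc |Q * ξ - P| ≤ |(x : ℝ)| * |Q * ξ - P| :=
        le_mul_of_one_le_left (abs_nonneg _) (by exact_mod_cast Int.one_le_abs hx0)
    _ = |x * (Q * ξ - P)| := (abs_mul _ _).symm
    _ ≤ |j * ξ - p| := by
        rw [hsum]
        exact sq_le_sq.1 (by nlinarith)

theorem abs_convergentError_le (k : ℕ) (hξ : Irrational ξ) {j : ℕ} (hj : 1 ≤ j)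
    (hjk : j < convergentDen ξ (k + 1)) (p : ℤ) : |convergentError ξ k| ≤ |j * ξ - p| := by
  have hdet : IsUnit ((ξ.convergent (k + 1)).num * (convergentDen ξ k : ℤ) -
      (ξ.convergent k).num * (convergentDen ξ (k + 1) : ℤ)) := by
    rw [convergent_det k hξ]
    exact (Int.isUnit_iff.2 (.inr rfl)).pow k
  have := abs_mul_sub_le_of_isUnit_det (ξ := ξ) (j := j) (p := p) hdet
    (by exact_mod_cast convergentError_mul_succ_nonpos k hξ)
    (Int.natCast_pos.2 (ξ.convergent k).den_pos) (by omega) (by omega)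
  exact_mod_cast this

theorem num_convergent_lt_succ_and_convergentDen_le_succ (n : ℕ) (hξ : Irrational ξ)
    (h1 : 1 < ξ) : (ξ.convergent n).num < (ξ.convergent (n + 1)).num ∧
      convergentDen ξ n ≤ convergentDen ξ (n + 1) := by
  have hfloor := one_le_floor_of_one_lt h1
  zify
  induction n generalizing ξ with
  | zero =>
    have hfloor' := one_le_floor_of_one_lt (one_lt_inv_fract hξ)
    rw [num_convergent_succ 0 hξ, convergentDen_succ 0 hξ]
    simp only [Real.convergent_zero, convergentDen_zero, Rat.num_intCast, Nat.cast_one]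
    exact ⟨by nlinarith, hfloor'⟩
  | succ n ih =>
    have h1' := one_lt_inv_fract hξ
    obtain ⟨hnum, hden⟩ := ih (irrational_inv_fract hξ) h1' (one_le_floor_of_one_lt h1')
    rw [num_convergent_succ n hξ, num_convergent_succ (n + 1) hξ, convergentDen_succ n hξ,
      convergentDen_succ (n + 1) hξ]
    exact ⟨by nlinarith, hnum.le⟩

theorem strictMono_convergentDen_succ (hξ : Irrational ξ) :
    StrictMono fun n => convergentDen ξ (n + 1) :=
  strictMono_nat_of_lt_succ fun n => by
    zify
    rw [convergentDen_succ n hξ, convergentDen_succ (n + 1) hξ]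
    exact (num_convergent_lt_succ_and_convergentDen_le_succ n (irrational_inv_fract hξ)
      (one_lt_inv_fract hξ)).1

theorem monotone_convergentDen (hξ : Irrational ξ) : Monotone (convergentDen ξ) :=
  monotone_nat_of_le_succ fun n => by
    cases n with
    | zero => exact (convergentDen_zero ξ).trans_le (ξ.convergent 1).den_pos
    | succ n => exact ((strictMono_convergentDen_succ hξ) n.lt_succ_self).le

theorem tendsto_convergentDen_atTop (hξ : Irrational ξ) :
    Tendsto (convergentDen ξ) atTop atTop :=
  (tendsto_add_atTop_iff_nat 1).1 (strictMono_convergentDen_succ hξ).tendsto_atTop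

theorem norm_nsmul_coe_eq_distNearestInt (ξ : ℝ) (n : ℕ) :
    ‖n • (ξ : UnitAddCircle)‖ = distNearestInt (n * ξ) := by
  rw [← AddCircle.coe_nsmul, UnitAddCircle.norm_eq, distNearestInt, nsmul_eq_mul]

theorem returnDist_coe_eq_of_mem_Ico (hξ : Irrational ξ) {k n : ℕ}
    (hn : n ∈ Finset.Ico (convergentDen ξ k) (convergentDen ξ (k + 1))) :
    returnDist (ξ : UnitAddCircle) n = distNearestInt (convergentDen ξ k * ξ) := by
  obtain ⟨hkn, hnk⟩ := Finset.mem_Ico.1 hn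
  have hk : 1 ≤ convergentDen ξ k := (ξ.convergent k).den_pos
  rw [← norm_nsmul_coe_eq_distNearestInt]
  refine (returnDist_le_norm_nsmul hk hkn).antisymm ?_
  obtain ⟨j, hj, hjn, hjξ⟩ :=
    exists_norm_nsmul_eq_returnDist (α := (ξ : UnitAddCircle)) (hk.trans hkn)
  rw [← hjξ, norm_nsmul_coe_eq_distNearestInt, norm_nsmul_coe_eq_distNearestInt]
  exact (round_le _ _).trans (abs_convergentError_le k hξ hj (hjn.trans_lt hnk) _)

end Convergent

section Blocks

theorem sum_range_sum_Ico {M : Type*} [AddCommMonoid M] {q : ℕ → ℕ} (hq : Monotone q)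
    (f : ℕ → M) (K : ℕ) :
    ∑ k ∈ Finset.range K, ∑ n ∈ Finset.Ico (q k) (q (k + 1)), f n =
      ∑ n ∈ Finset.Ico (q 0) (q K), f n := by
  induction K with
  | zero => simp
  | succ K ih =>
    rw [Finset.sum_range_succ, ih, Finset.sum_Ico_consecutive f (hq K.zero_le) (hq K.le_succ)]

theorem tendsto_sum_blocks_atTop_iff {q : ℕ → ℕ} (hq : Monotone q) (hq' : Tendsto q atTop atTop)
    {f : ℕ → ℝ} (hf : 0 ≤ f) :
    Tendsto (fun K => ∑ k ∈ Finset.range K, ∑ n ∈ Finset.Ico (q k) (q (k + 1)), f n)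
      atTop atTop ↔ ¬ Summable f := by
  simp only [sum_range_sum_Ico hq, Finset.sum_Ico_eq_sub f (hq (Nat.zero_le _))]
  refine ⟨fun h hsum => ?_, fun hsum => ?_⟩
  · exact not_tendsto_atTop_of_tendsto_nhds
      ((hsum.hasSum.tendsto_sum_nat.comp hq').sub_const _) h
  · exact tendsto_atTop_add_const_right _ _
      (((not_summable_iff_tendsto_nat_atTop_of_nonneg hf).1 hsum).comp hq')

end Blocks

section Real

variable {θ : ℝ} {ψ : ℕ → ℝ}

theorem ae_real_of_ae_unitAddCircle {p : UnitAddCircle → Prop} (hp : ∀ᵐ x, p x) :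
    ∀ᵐ s : ℝ, p s := by
  have hunit : ∀ t : ℤ, ∀ᵐ s : ℝ ∂volume.restrict (Ioc (t : ℝ) (t + 1)), p s :=
    fun t => (UnitAddCircle.measurePreserving_mk (t : ℝ)).quasiMeasurePreserving.ae hp
  rwa [← ae_restrict_iUnion_iff, iUnion_Ioc_intCast, Measure.restrict_univ] at hunit

theorem addOrderOf_coe_eq_zero_of_irrational (hθ : Irrational θ) :
    addOrderOf (θ : UnitAddCircle) = 0 := by
  refine addOrderOf_eq_zero_iff'.2 fun n hn h0 => ?_
  rw [← AddCircle.coe_nsmul, AddCircle.coe_eq_zero_iff] at h0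
  obtain ⟨m, hm⟩ := h0
  exact (hθ.natCast_mul hn.ne').ne_int m (by simpa using hm.symm)

theorem infinite_setOf_distNearestInt_lt_iff (s : ℝ) :
    {n : ℕ | 1 ≤ n ∧ distNearestInt (n * θ - s) < ψ n}.Infinite ↔
      (s : UnitAddCircle) ∈ approxSet (fun n => ψ (max 1 n)) (θ : UnitAddCircle) := by
  rw [← Nat.frequently_atTop_iff_infinite, approxSet, mem_limsup_iff_frequently_mem]
  refine frequently_congr ((eventually_ge_atTop 1).mono fun n hn => ?_)
  rw [mem_ball', dist_eq_norm, ← AddCircle.coe_nsmul, ← AddCircle.coe_sub, UnitAddCircle.norm_eq,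
    max_eq_right hn, nsmul_eq_mul, distNearestInt, and_iff_right hn]

theorem tendsto_sum_convergentDen_atTop_iff (hθ : Irrational θ) (hψ : ∀ n, 1 ≤ n → 0 ≤ ψ n) :
    Tendsto (fun K => ∑ k ∈ Finset.range K,
        ∑ n ∈ Finset.Ico (convergentDen θ k) (convergentDen θ (k + 1)),
          min (ψ n) (distNearestInt (convergentDen θ k * θ))) atTop atTop ↔
      ¬ Summable (returnWeight (fun n => ψ (max 1 n)) (θ : UnitAddCircle)) := by
  rw [← tendsto_sum_blocks_atTop_iff (monotone_convergentDen hθ) (tendsto_convergentDen_atTop hθ)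
    (returnWeight_nonneg fun n => hψ _ (le_max_left 1 n))]
  refine tendsto_congr fun K => Finset.sum_congr rfl fun k _ => Finset.sum_congr rfl fun n hn => ?_
  have hn1 : 1 ≤ n := (θ.convergent k).den_pos.trans_le (Finset.mem_Ico.1 hn).1
  rw [returnWeight, returnDist_coe_eq_of_mem_Ico hθ hn, max_eq_right hn1]

end Real

theorem mainTheorem1 (ψ : ℕ → ℝ) (hψ_pos : ∀ n : ℕ, 1 ≤ n → 0 < ψ n)
    (hψ_anti : ∀ m n : ℕ, 1 ≤ m → m ≤ n → ψ n ≤ ψ m)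
    (θ : ℝ) (hθ : Irrational θ) :
    ∀ᵐ s : ℝ ∂MeasureTheory.volume,
      ({n : ℕ | 1 ≤ n ∧ distNearestInt ((n : ℝ) * θ - s) < ψ n}.Infinite ↔
        Filter.Tendsto
          (fun K : ℕ => ∑ k ∈ Finset.range K,
            ∑ n ∈ Finset.Ico (convergentDen θ k) (convergentDen θ (k + 1)),
              min (ψ n) (distNearestInt ((convergentDen θ k : ℝ) * θ)))
          Filter.atTop Filter.atTop) := by
  have hanti : Antitone fun n => ψ (max 1 n) := fun m n hmn =>
    hψ_anti _ _ (le_max_left _ _) (max_le_max le_rfl hmn)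
  have hnonneg : 0 ≤ fun n => ψ (max 1 n) := fun n => (hψ_pos _ (le_max_left _ _)).le
  filter_upwards [ae_real_of_ae_unitAddCircle <|
    ae_mem_approxSet_iff (addOrderOf_coe_eq_zero_of_irrational hθ) hanti hnonneg] with s hs
  rw [infinite_setOf_distNearestInt_lt_iff, hs,
    tendsto_sum_convergentDen_atTop_iff hθ fun n hn => (hψ_pos n hn).le]
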